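/- Let $p\in[1,\infty]$, let $\mathbb K\in\{\mathbb R,\mathbb C\}$ be the common scalar field of all spaces below, and let $L_p=L_p(\Omega,\mu)$ for a measure space $(\Omega,\mu)$ (for example $[0,1]$ with Lebesgue measure). Let $M\subset L_p$ be a subset which, with the metric induced by $\|\cdot\|_p$, is a proper metric space, i.e. all closed balls of $M$ are compact. Let $Y$ be a Banach space that contains the $\ell_p^n$'s uniformly, i.e. there is $\lambda\in[1,\infty)$ such that for every $n\ge 1$ there is a linear subspace $E_n\subset Y$, linearly isomorphic to $\ell_p^n$, with $d_{BM}(E_n,\ell_p^n)\le\lambda$, where $d_{BM}(E,F)=\inf\{\|T\|\,\|T^{-1}\| : T\colon E\to F \text{ a linear isomorphism}\}$ is the Banach–Mazur distance. Then $M$ almost Lipschitzly embeds into $Y$: there exist $r\in(0,\infty)$ and $D\in[1,\infty)$ such that for every continuous function $\varphi\colon[0,\infty)\to[0,1)$ with $\varphi(0)=0$ and $\varphi(t)>0$ for all $t>0$, there is a map $f_\varphi\colon M\to Y$ satisfying, for all $x,y\in M$, $$\varphi(\|x-y\|_p)\,r\,\|x-y\|_p\le\|f_\varphi(x)-f_\varphi(y)\|_Y\le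 D\,r\,\|x-y\|_p .$$ -/

import Mathlib

open MeasureTheory
open scoped NNReal ENNReal

/-- The class `Φ` of continuous functions `φ : [0,∞) → [0,1)` with `φ 0 = 0` and `φ t > 0`
for all `t > 0`. -/
def almostLipschitzGauges : Set (ℝ≥0 → ℝ) :=
  {φ | Continuous φ ∧ (∀ t, φ t ∈ Set.Ico (0 : ℝ) 1) ∧ φ 0 = 0 ∧ ∀ t, 0 < t → 0 < φ t}

/-- `X` almost Lipschitzly embeds into `Y`: there are a scaling factor `r ∈ (0,∞)` and a constant
`D ∈ [1,∞)` such that for every `φ ∈ Φ` there is a map `f : X → Y` with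
`φ(d(x,y)) r d(x,y) ≤ d(f x, f y) ≤ D r d(x,y)` for all `x, y`. -/
def AlmostLipschitzEmbeds (X Y : Type*) [MetricSpace X] [MetricSpace Y] : Prop :=
  ∃ r D : ℝ, 0 < r ∧ 1 ≤ D ∧ ∀ φ ∈ almostLipschitzGauges, ∃ f : X → Y, ∀ x y : X,
    φ (nndist x y) * r * dist x y ≤ dist (f x) (f y) ∧ dist (f x) (f y) ≤ D * r * dist x y

/-- The Banach-Mazur distance `inf ‖T‖ ‖T⁻¹‖` over all linear isomorphisms `T : E → F`; it is `∞`
when `E` and `F` are not isomorphic. -/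
noncomputable def banachMazurDist (𝕜 : Type*) [RCLike 𝕜] (E F : Type*)
    [NormedAddCommGroup E] [NormedSpace 𝕜 E] [NormedAddCommGroup F] [NormedSpace 𝕜 F] : ℝ≥0∞ :=
  ⨅ T : E ≃L[𝕜] F, ENNReal.ofReal (‖(T : E →L[𝕜] F)‖ * ‖(T.symm : F →L[𝕜] E)‖)

/-- `Y` contains the `ℓ_p^n`'s `C`-uniformly: for every `n ≥ 1` there is a linear subspace of `Y`
at Banach-Mazur distance at most `C` from `ℓ_p^n` (in particular, isomorphic to it). -/
def ContainsEllpnWithConst (𝕜 : Type*) [RCLike 𝕜] (p : ℝ≥0∞) [Fact (1 ≤ p)] (C : ℝ)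
    (Y : Type*) [NormedAddCommGroup Y] [NormedSpace 𝕜 Y] : Prop :=
  ∀ n : ℕ, 1 ≤ n → ∃ E : Submodule 𝕜 Y,
    banachMazurDist 𝕜 E (PiLp p (fun _ : Fin n => 𝕜)) ≤ ENNReal.ofReal C

/-- `Y` contains the `ℓ_p^n`'s uniformly: `C`-uniformly for some `C ∈ [1,∞)`. -/
def ContainsEllpnUniformly (𝕜 : Type*) [RCLike 𝕜] (p : ℝ≥0∞) [Fact (1 ≤ p)]
    (Y : Type*) [NormedAddCommGroup Y] [NormedSpace 𝕜 Y] : Prop :=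
  ∃ C : ℝ, 1 ≤ C ∧ ContainsEllpnWithConst 𝕜 p C Y

/-!
The embedding is assembled from three ingredients.

*Local structure of `L_p`.* For a compact `K ⊆ L_p` and `ε > 0` there is a linear contraction
`P : L_p → ℓ_p^n` with `‖P x‖ ≥ ‖x‖ - ε` on `K` (`MeasureTheory.Lp.exists_linearMap_of_isCompact`).
It suffices to treat a finite subset of `K`. If `p = ∞`, take a norming functional at each point. If
`p < ∞`, approximate the points by functions that are simple with respect to a common partition, and
let `P` be the normalized averages over the cells: it is contractive by Hölder's inequality and
isometric on functions that are constant on the cells.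

*Almost independent copies of `ℓ_p^n` in `Y`.* Every finite-codimensional subspace of `Y` contains
the `ℓ_p^n`'s with the same constant: if `d` functionals are to be annihilated, cut `ℓ_p^{n(d+1)}`
into `n` blocks of length `d + 1` and choose in each block a unit vector which they annihilate.
Choosing successively copies annihilated by finitely many functionals that norm, up to a factor `2`,
the span of the previous copies, one gets operators `T i : ℓ_p^{n i} → Y` such that a convergent sum
`∑ T i (h i)` has norm at least `‖h i‖ / 4` for every `i`
(`ContainsEllpnWithConst.exists_sequence`).

*Gluing.* After a translation, `M` contains the origin. A partition of unity `tent k` along the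
shells `‖x‖ ∼ 2 ^ k` writes `x = ∑ k, tent k ‖x‖ • x`, where each summand is Lipschitz in `x` with a
universal constant, and takes values in a compact set as `x` runs through `M`. For a sequence
`s j > 0` let `P k j` be a contraction into some `ℓ_p^n` that preserves norms up to `s j / 8` on
differences of values of the `k`-th summand. The map is
`f x = ∑ k, ∑ j, 2 ^ (-j) • T k j (P k j (tent k ‖x‖ • x))`. It is Lipschitz because the weights are
summable and at most four shells see a given pair of points. For the same reason some `k` satisfies
`‖tent k ‖x‖ • x - tent k ‖y‖ • y‖ ≥ ‖x - y‖ / 4`, and then the single summand `(k, j)` shows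
`‖f x - f y‖ ≥ 2 ^ (-j) ‖x - y‖ / 32` whenever `‖x - y‖ ≥ s j` (`exists_sum_of_scales`). Since `φ` is
continuous and vanishes at `0`, the `s j` can be chosen so small that every `t > 0` has some `j` with
`s j ≤ t` and `φ t ≤ 2 ^ (-j)` (`exists_scales`). The constants do not depend on `φ`: only the `s j`
do.
-/

universe u

/-! ### Copies of `ℓ_p^n` in finite-codimensional subspaces -/

/-- A finite-dimensional subspace is normed up to a factor `2` by finitely many functionals: norming
functionals at the points of a `1/4`-net of the unit sphere. -/
theorem exists_finset_norming {𝕜 : Type*} [RCLike 𝕜] {Y : Type*} [NormedAddCommGroup Y]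
    [NormedSpace 𝕜 Y] (F : Submodule 𝕜 Y) [FiniteDimensional 𝕜 F] :
    ∃ G : Finset (Y →L[𝕜] 𝕜), (∀ g ∈ G, ‖g‖ ≤ 1) ∧ ∀ u ∈ F, ∃ g ∈ G, ‖u‖ ≤ 2 * ‖g u‖ := by
  classical
  have : ProperSpace F := FiniteDimensional.proper_rclike 𝕜 F
  obtain ⟨t, -, htf, ht⟩ := (isCompact_sphere (0 : F) 1).finite_cover_balls
    (e := 1 / 4) (by norm_num)
  have hg : ∀ v : Y, ∃ g : Y →L[𝕜] 𝕜, ‖g‖ ≤ 1 ∧ g v = ‖v‖ := fun v => exists_dual_vector'' 𝕜 v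
  choose g hg1 hgv using hg
  refine ⟨insert 0 (htf.toFinset.image fun v => g v), ?_, ?_⟩
  · intro f hf
    rcases Finset.mem_insert.1 hf with rfl | hf
    · simp
    · obtain ⟨v, -, rfl⟩ := Finset.mem_image.1 hf
      exact hg1 _
  · intro u hu
    rcases eq_or_ne u 0 with rfl | hu0
    · exact ⟨0, by simp, by simp⟩
    have hun : (0 : ℝ) < ‖u‖ := norm_pos_iff.2 hu0
    set w : F := ((‖u‖⁻¹ : ℝ) : 𝕜) • ⟨u, hu⟩ with hw
    have hwn : ‖w‖ = 1 := by
      rw [hw, norm_smul, RCLike.norm_ofReal, abs_of_pos (inv_pos.2 hun)]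
      exact inv_mul_cancel₀ hun.ne'
    have hws : w ∈ Metric.sphere (0 : F) 1 := by simpa using hwn
    obtain ⟨v, hv, hvw⟩ := Set.mem_iUnion₂.1 (ht hws)
    refine ⟨g v, Finset.mem_insert_of_mem (Finset.mem_image_of_mem _ (by simpa using hv)), ?_⟩
    have hd : ‖(w : Y) - v‖ < 1 / 4 := by
      rw [← Submodule.coe_sub]
      exact (dist_eq_norm w v).symm.trans_lt hvw
    -- `g v` attains the norm at `v`, and `v` is `1/4`-close to the normalization `w` of `u`.
    have h1 : ‖(v : Y)‖ - ‖(w : Y) - v‖ ≤ ‖g v w‖ := by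
      have h2 : g v w = g v v + g v (w - v) := by simp
      have h3 : ‖g v (w - v)‖ ≤ ‖(w : Y) - v‖ :=
        ((g v).le_of_opNorm_le (hg1 _) _).trans (one_mul _).le
      have h4 : ‖g v v‖ = ‖(v : Y)‖ := by rw [hgv]; simp
      have h5 := norm_sub_le_norm_add (g v v) (g v (w - v))
      rw [h2]; linarith
    have h6 : ‖(w : Y)‖ - ‖(w : Y) - v‖ ≤ ‖(v : Y)‖ := by
      have := norm_sub_norm_le (w : Y) ((w : Y) - v)
      simpa using this
    have h7 : ‖(w : Y)‖ = 1 := hwn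
    have h8 : 1 ≤ 2 * ‖g v w‖ := by linarith
    have h9 : ‖g v w‖ = ‖u‖⁻¹ * ‖g v u‖ := by
      rw [hw]
      simp
    rw [h9] at h8
    calc ‖u‖ = ‖u‖ * 1 := (mul_one _).symm
      _ ≤ ‖u‖ * (2 * (‖u‖⁻¹ * ‖g v u‖)) := by gcongr
      _ = 2 * ‖g v u‖ := by field_simp

theorem PiLp.norm_congr {p : ℝ≥0∞} [Fact (1 ≤ p)] {ι : Type*} [Fintype ι] {α β : ι → Type*}
    [∀ i, SeminormedAddCommGroup (α i)] [∀ i, SeminormedAddCommGroup (β i)]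
    {f : PiLp p α} {g : PiLp p β} (h : ∀ i, ‖f i‖ = ‖g i‖) : ‖f‖ = ‖g‖ := by
  rcases eq_or_ne p ∞ with rfl | hp
  · simp [PiLp.norm_eq_ciSup, h]
  · have : 0 < p.toReal := ENNReal.toReal_pos (zero_lt_one.trans_le Fact.out).ne' hp
    simp [PiLp.norm_eq_sum this, h]

/-- An isomorphism `S` from a subspace of `Y` onto `ℓ_p^n` with `‖S‖ ‖S⁻¹‖ < C'`, inverted and rescaled
by `‖S‖`. -/
theorem ContainsEllpnWithConst.exists_linearMap {𝕜 : Type*} [RCLike 𝕜] {p : ℝ≥0∞}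
    [Fact (1 ≤ p)] {C : ℝ} {Y : Type*} [NormedAddCommGroup Y] [NormedSpace 𝕜 Y]
    (hY : ContainsEllpnWithConst 𝕜 p C Y) {C' : ℝ} (hC : C < C') (hC0 : 0 < C')
    (ι : Type*) [Fintype ι] [Nonempty ι] :
    ∃ T : PiLp p (fun _ : ι => 𝕜) →ₗ[𝕜] Y, ∀ z, ‖z‖ ≤ ‖T z‖ ∧ ‖T z‖ ≤ C' * ‖z‖ := by
  obtain ⟨E, hE⟩ := hY (Fintype.card ι) Fintype.card_pos
  obtain ⟨S, hS⟩ := iInf_lt_iff.1 (hE.trans_lt ((ENNReal.ofReal_lt_ofReal_iff hC0).2 hC))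
  have hS' := (ENNReal.ofReal_lt_ofReal_iff hC0).1 hS
  let e := LinearIsometryEquiv.piLpCongrLeft p 𝕜 𝕜 (Fintype.equivFin ι)
  refine ⟨((‖(S : E →L[𝕜] PiLp p (fun _ : Fin (Fintype.card ι) => 𝕜))‖ : ℝ) : 𝕜) •
    (E.subtype ∘ₗ S.symm.toLinearEquiv.toLinearMap ∘ₗ e.toLinearEquiv.toLinearMap), fun z => ?_⟩
  have hT : ‖(((‖(S : E →L[𝕜] PiLp p (fun _ : Fin (Fintype.card ι) => 𝕜))‖ : ℝ) : 𝕜) •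
    (E.subtype ∘ₗ S.symm.toLinearEquiv.toLinearMap ∘ₗ e.toLinearEquiv.toLinearMap)) z‖
      = ‖(S : E →L[𝕜] PiLp p (fun _ : Fin (Fintype.card ι) => 𝕜))‖ * ‖S.symm (e z)‖ := by
    simp [norm_smul]
  rw [hT]
  constructor
  · have := (S : E →L[𝕜] PiLp p (fun _ : Fin (Fintype.card ι) => 𝕜)).le_opNorm (S.symm (e z))
    simpa using this
  · have := (S.symm : PiLp p (fun _ : Fin (Fintype.card ι) => 𝕜) →L[𝕜] E).le_opNorm (e z)
    rw [LinearIsometryEquiv.norm_map] at this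
    calc _ ≤ ‖(S : E →L[𝕜] PiLp p (fun _ : Fin (Fintype.card ι) => 𝕜))‖ *
          (‖(S.symm : PiLp p (fun _ : Fin (Fintype.card ι) => 𝕜) →L[𝕜] E)‖ * ‖z‖) := by
          gcongr; exact this
      _ ≤ C' * ‖z‖ := by rw [← mul_assoc]; gcongr

theorem exists_unit_mem_ker {𝕜 : Type*} [RCLike 𝕜] (p : ℝ≥0∞) [Fact (1 ≤ p)] {d : ℕ}
    {V : Type*} [AddCommGroup V] [Module 𝕜 V] [FiniteDimensional 𝕜 V]
    (hV : Module.finrank 𝕜 V ≤ d) (A : PiLp p (fun _ : Fin (d + 1) => 𝕜) →ₗ[𝕜] V) :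
    ∃ c, ‖c‖ = 1 ∧ A c = 0 := by
  have h1 : LinearMap.ker A ≠ ⊥ := by
    apply LinearMap.ker_ne_bot_of_finrank_lt
    rw [(WithLp.linearEquiv p 𝕜 (Fin (d + 1) → 𝕜)).finrank_eq]
    simp; omega
  obtain ⟨c, hc, hc0⟩ := (Submodule.ne_bot_iff _).1 h1
  refine ⟨((‖c‖⁻¹ : ℝ) : 𝕜) • c, ?_, ?_⟩
  · rw [norm_smul, RCLike.norm_ofReal, abs_of_nonneg (by positivity)]
    exact inv_mul_cancel₀ (norm_ne_zero_iff.2 hc0)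
  · rw [map_smul, LinearMap.mem_ker.1 hc, smul_zero]

/-- A block argument: the copies of `ℓ_p^n` can be found, with the same constant, inside the common
kernel of finitely many functionals. -/
theorem ContainsEllpnWithConst.exists_linearMap_ker {𝕜 : Type*} [RCLike 𝕜] {p : ℝ≥0∞}
    [Fact (1 ≤ p)] {C : ℝ} {Y : Type*} [NormedAddCommGroup Y] [NormedSpace 𝕜 Y]
    (hY : ContainsEllpnWithConst 𝕜 p C Y) {C' : ℝ} (hC : C < C') (hC0 : 0 < C')
    (G : Finset (Y →L[𝕜] 𝕜)) (ι : Type) [Fintype ι] :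
    ∃ T : PiLp p (fun _ : ι => 𝕜) →ₗ[𝕜] Y,
      (∀ z, ‖z‖ ≤ ‖T z‖ ∧ ‖T z‖ ≤ C' * ‖z‖) ∧ ∀ g ∈ G, ∀ z, g (T z) = 0 := by
  classical
  rcases isEmpty_or_nonempty ι with hι | hι
  · exact ⟨0, fun z => by simp [Subsingleton.elim z 0], by simp⟩
  have : Nonempty (Σ _ : ι, Fin (G.card + 1)) := ⟨⟨hι.some, 0⟩⟩
  obtain ⟨S, hS⟩ := hY.exists_linearMap hC hC0 (Σ _ : ι, Fin (G.card + 1))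
  let e := LinearIsometryEquiv.piLpCurry 𝕜 p (fun (_ : ι) (_ : Fin (G.card + 1)) => 𝕜)
  let S' : PiLp p (fun _ : ι => PiLp p (fun _ : Fin (G.card + 1) => 𝕜)) →ₗ[𝕜] Y :=
    S ∘ₗ e.symm.toLinearEquiv.toLinearMap
  have hS' : ∀ z, ‖z‖ ≤ ‖S' z‖ ∧ ‖S' z‖ ≤ C' * ‖z‖ := fun z => by
    simpa [S'] using hS (e.symm z)
  -- The functionals in `G`, evaluated on the `i`-th block.
  let A : ι → PiLp p (fun _ : Fin (G.card + 1) => 𝕜) →ₗ[𝕜] (G → 𝕜) := fun i =>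
    LinearMap.pi (fun g : G => (g : Y →L[𝕜] 𝕜).toLinearMap) ∘ₗ S' ∘ₗ
      (WithLp.linearEquiv p 𝕜 _).symm.toLinearMap ∘ₗ LinearMap.single 𝕜
        (fun _ : ι => PiLp p (fun _ : Fin (G.card + 1) => 𝕜)) i
  have hc : ∀ i, ∃ c, ‖c‖ = 1 ∧ A i c = 0 := fun i => exists_unit_mem_ker p (by simp) (A i)
  choose c hc1 hcA using hc
  -- The isometry sending the `i`-th unit vector to the unit vector `c i` of the `i`-th block.
  let J : PiLp p (fun _ : ι => 𝕜) →ₗ[𝕜]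
      PiLp p (fun _ : ι => PiLp p (fun _ : Fin (G.card + 1) => 𝕜)) :=
    { toFun := fun a => WithLp.toLp p fun i => a i • c i
      map_add' := fun a b => by ext i; simp [add_mul]
      map_smul' := fun t a => by ext i; simp [mul_assoc] }
  have hJ : ∀ a, ‖J a‖ = ‖a‖ := fun a => PiLp.norm_congr fun i => by
    simp [J, norm_smul, hc1]
  refine ⟨S' ∘ₗ J, fun z => by simpa [hJ] using hS' (J z), fun g hg z => ?_⟩
  have hz : J z = ∑ i, z i • WithLp.toLp p (Pi.single i (c i)) := by
    ext i s
    simp [J, Pi.single_apply]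
  have h0 : ∀ i, g (S' (WithLp.toLp p (Pi.single i (c i)))) = 0 := fun i =>
    congrFun (hcA i) ⟨g, hg⟩
  simp only [LinearMap.comp_apply, hz, map_sum, map_smul, h0, smul_zero, Finset.sum_const_zero]

/-! ### Almost independent sequences of copies of `ℓ_p^n` -/

/-- A finite-dimensional subspace of `Y` with a finite set of functionals in the dual unit ball that
norms it up to a factor `2`. -/
structure NormingSystem (𝕜 : Type*) [RCLike 𝕜] (Y : Type*) [NormedAddCommGroup Y]
    [NormedSpace 𝕜 Y] where
  space : Submodule 𝕜 Y
  functionals : Finset (Y →L[𝕜] 𝕜)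
  finiteDimensional : FiniteDimensional 𝕜 space
  norm_le_one : ∀ g ∈ functionals, ‖g‖ ≤ 1
  norming : ∀ u ∈ space, ∃ g ∈ functionals, ‖u‖ ≤ 2 * ‖g u‖

/-- A norming system can be enlarged by a copy of `ℓ_p^m` which its functionals annihilate. -/
theorem NormingSystem.exists_extend {𝕜 : Type*} [RCLike 𝕜] {p : ℝ≥0∞}
    [Fact (1 ≤ p)] {C : ℝ} {Y : Type*} [NormedAddCommGroup Y] [NormedSpace 𝕜 Y]
    (hY : ContainsEllpnWithConst 𝕜 p C Y) {C' : ℝ} (hC : C < C') (hC0 : 0 < C')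
    (s : NormingSystem 𝕜 Y) (m : ℕ) :
    ∃ (T : PiLp p (fun _ : Fin m => 𝕜) →ₗ[𝕜] Y) (s' : NormingSystem 𝕜 Y),
      (∀ z, ‖z‖ ≤ ‖T z‖ ∧ ‖T z‖ ≤ C' * ‖z‖) ∧ (∀ g ∈ s.functionals, ∀ z, g (T z) = 0) ∧
      s.space ≤ s'.space ∧ (∀ z, T z ∈ s'.space) ∧ s.functionals ⊆ s'.functionals := by
  classical
  obtain ⟨T, hT, hT0⟩ := hY.exists_linearMap_ker hC hC0 s.functionals (Fin m)
  have := s.finiteDimensional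
  obtain ⟨G, hG1, hG⟩ := exists_finset_norming (s.space ⊔ LinearMap.range T)
  refine ⟨T, ⟨s.space ⊔ LinearMap.range T, s.functionals ∪ G, inferInstance, ?_, ?_⟩, hT, hT0,
    le_sup_left, fun z => le_sup_right (a := s.space) (LinearMap.mem_range_self T z),
    Finset.subset_union_left⟩
  · intro g hg
    exact (Finset.mem_union.1 hg).elim (s.norm_le_one g) (hG1 g)
  · intro u hu
    obtain ⟨g, hg, h⟩ := hG u hu
    exact ⟨g, Finset.mem_union_right _ hg, h⟩

/-- Copies of the `ℓ_p^{n i}` in `Y` for which every coordinate of a convergent sum is controlled by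
the norm of the sum. The functionals that norm the span of the first `i` copies annihilate all later
ones, so each partial sum has at most twice the norm of the whole sum. -/
theorem ContainsEllpnWithConst.exists_sequence {𝕜 : Type*} [RCLike 𝕜] {p : ℝ≥0∞}
    [Fact (1 ≤ p)] {C : ℝ} {Y : Type*} [NormedAddCommGroup Y] [NormedSpace 𝕜 Y]
    (hY : ContainsEllpnWithConst 𝕜 p C Y) {C' : ℝ} (hC : C < C') (hC0 : 0 < C') (n : ℕ → ℕ) :
    ∃ T : ∀ i, PiLp p (fun _ : Fin (n i) => 𝕜) →ₗ[𝕜] Y,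
      (∀ i z, ‖T i z‖ ≤ C' * ‖z‖) ∧
      ∀ h : ∀ i, PiLp p (fun _ : Fin (n i) => 𝕜), Summable (fun i => T i (h i)) →
        ∀ i, ‖h i‖ ≤ 4 * ‖∑' l, T l (h l)‖ := by
  choose T next hT hT0 hspace hrange hfun using fun s : NormingSystem 𝕜 Y => s.exists_extend hY hC hC0
  obtain ⟨G₀, hG₀, hG₀'⟩ := exists_finset_norming (⊥ : Submodule 𝕜 Y)
  let s : ℕ → NormingSystem 𝕜 Y := fun i =>
    Nat.rec ⟨⊥, G₀, inferInstance, hG₀, hG₀'⟩ (fun i s => next s (n i)) i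
  have hs : ∀ i, s (i + 1) = next (s i) (n i) := fun i => rfl
  have hsF : Monotone fun i => (s i).space :=
    monotone_nat_of_le_succ fun i => by simpa only [hs] using hspace (s i) (n i)
  have hsG : Monotone fun i => (s i).functionals :=
    monotone_nat_of_le_succ fun i => by simpa only [hs] using hfun (s i) (n i)
  refine ⟨fun i => T (s i) (n i), fun i z => (hT (s i) (n i) z).2, fun h hsum i => ?_⟩
  set v : ℕ → Y := fun l => T (s l) (n l) (h l) with hv
  have hpart : ∀ i, ‖∑ l ∈ Finset.range i, v l‖ ≤ 2 * ‖∑' l, v l‖ := fun i => by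
    have hmem : ∑ l ∈ Finset.range i, v l ∈ (s i).space := by
      refine Submodule.sum_mem _ fun l hl => ?_
      refine hsF (Nat.succ_le_of_lt (Finset.mem_range.1 hl)) ?_
      change v l ∈ (s (l + 1)).space
      rw [hs]
      exact hrange (s l) (n l) (h l)
    obtain ⟨g, hg, hgu⟩ := (s i).norming _ hmem
    have htail : g (∑' l, v (l + i)) = 0 := by
      rw [g.map_tsum ((summable_nat_add_iff i).2 hsum)]
      refine (tsum_congr fun l => ?_).trans tsum_zero
      exact hT0 (s (l + i)) (n (l + i)) g (hsG (Nat.le_add_left i l) hg) (h (l + i))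
    have hgt : g (∑' l, v l) = g (∑ l ∈ Finset.range i, v l) := by
      rw [← hsum.sum_add_tsum_nat_add i, map_add, htail, add_zero]
    rw [← hgt] at hgu
    have := (g.le_of_opNorm_le ((s i).norm_le_one g hg) (∑' l, v l))
    linarith
  have h1 : v i = ∑ l ∈ Finset.range (i + 1), v l - ∑ l ∈ Finset.range i, v l := by
    rw [Finset.sum_range_succ]; abel
  calc ‖h i‖ ≤ ‖v i‖ := (hT (s i) (n i) (h i)).1
    _ ≤ 4 * ‖∑' l, v l‖ := by
      rw [h1]
      have h2 := hpart i
      have h3 := hpart (i + 1)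
      exact (norm_sub_le _ _).trans (by linarith)

/-! ### Approximate embeddings of compact sets into `ℓ_p^n` -/

/-- If finitely many vectors of `X` can be mapped to some `ℓ_p^n` by a linear contraction that almost
preserves their norms, then the same is true of the vectors of a compact set. -/
theorem exists_linearMap_of_finite_of_isCompact {𝕜 : Type*} [RCLike 𝕜] {p : ℝ≥0∞} [Fact (1 ≤ p)]
    {X : Type*} [NormedAddCommGroup X] [NormedSpace 𝕜 X]
    (hX : ∀ (m : ℕ) (z : Fin m → X) (ε : ℝ), 0 < ε →
      ∃ (ι : Type*) (_ : Fintype ι) (P : X →ₗ[𝕜] PiLp p (fun _ : ι => 𝕜)),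
        (∀ x, ‖P x‖ ≤ ‖x‖) ∧ ∀ i, ‖z i‖ - ε ≤ ‖P (z i)‖)
    {K : Set X} (hK : IsCompact K) {ε : ℝ} (hε : 0 < ε) :
    ∃ (n : ℕ) (P : X →ₗ[𝕜] PiLp p (fun _ : Fin n => 𝕜)),
      (∀ x, ‖P x‖ ≤ ‖x‖) ∧ ∀ x ∈ K, ‖x‖ - ε ≤ ‖P x‖ := by
  obtain ⟨t, -, htf, ht⟩ := hK.finite_cover_balls (e := ε / 3) (by positivity)
  obtain ⟨m, z, -, rfl⟩ := htf.fin_param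
  obtain ⟨ι, _, P, hP, hPz⟩ := hX _ z (ε / 3) (by positivity)
  let e := LinearIsometryEquiv.piLpCongrLeft p 𝕜 𝕜 (Fintype.equivFin ι)
  refine ⟨_, e.toLinearEquiv.toLinearMap ∘ₗ P, fun x => by simpa using hP x, fun x hx => ?_⟩
  obtain ⟨_, ⟨i, rfl⟩, hxi⟩ := Set.mem_iUnion₂.1 (ht hx)
  have h0 : ‖x - z i‖ < ε / 3 := by simpa [dist_eq_norm] using hxi
  have h1 : ‖x‖ - ‖x - z i‖ ≤ ‖z i‖ := by simpa using norm_sub_norm_le x (x - z i)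
  have h2 : ‖P (z i)‖ - ‖P (x - z i)‖ ≤ ‖P x‖ := by
    have := norm_sub_le_norm_add (P (z i)) (P (x - z i))
    rwa [← map_add, add_sub_cancel] at this
  have h3 := hP (x - z i)
  have h4 := hPz i
  have h5 : ‖(e.toLinearEquiv.toLinearMap ∘ₗ P) x‖ = ‖P x‖ := by simp
  rw [h5]
  linarith

/-- Norming functionals at the vectors `z i` are the coordinates of the map. -/
theorem exists_linearMap_of_finite_top (𝕜 : Type*) [RCLike 𝕜]
    {X : Type*} [NormedAddCommGroup X] [NormedSpace 𝕜 X] {m : ℕ} (z : Fin m → X) :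
    ∃ P : X →ₗ[𝕜] PiLp ∞ (fun _ : Fin m => 𝕜), (∀ x, ‖P x‖ ≤ ‖x‖) ∧ ∀ i, ‖z i‖ ≤ ‖P (z i)‖ := by
  choose g hg hgz using fun x : X => exists_dual_vector'' 𝕜 x
  refine ⟨(WithLp.linearEquiv ∞ 𝕜 (Fin m → 𝕜)).symm.toLinearMap ∘ₗ
    LinearMap.pi fun i => (g (z i)).toLinearMap, fun x => ?_, fun i => ?_⟩
  · rw [PiLp.norm_eq_ciSup]
    refine Real.iSup_le (fun i => ?_) (norm_nonneg x)
    exact ((g (z i)).le_of_opNorm_le (hg _) x).trans (one_mul _).le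
  · refine le_trans (le_of_eq ?_) (PiLp.norm_apply_le _ i)
    simp [hgz]

section
variable {𝕜 : Type*} [RCLike 𝕜] {p : ℝ≥0∞} [Fact (1 ≤ p)] {Ω : Type*} [MeasurableSpace Ω]
  {μ : Measure Ω} {ι : Type*}

/-- The normalized averages `μ(A i)^(1/p - 1) ∫_{A i} f` of `f` over sets `A i` of finite measure. The
coordinate of a null set is `0`, as its integral vanishes. -/
noncomputable def averages (A : ι → Set Ω) (hA : ∀ i, μ (A i) ≠ ∞) :
    Lp 𝕜 p μ →ₗ[𝕜] PiLp p (fun _ : ι => 𝕜) where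
  toFun f := WithLp.toLp p fun i =>
    ((μ.real (A i) ^ (1 / p.toReal - 1) : ℝ) : 𝕜) * ∫ ω in A i, f ω ∂μ
  map_add' f g := by
    ext i
    have h : ∫ ω in A i, (f + g : Lp 𝕜 p μ) ω ∂μ = ∫ ω in A i, (f ω + g ω) ∂μ :=
      integral_congr_ae (ae_restrict_of_ae (Lp.coeFn_add f g))
    simp only [PiLp.add_apply]
    rw [h, integral_add (integrableOn_Lp_of_measure_ne_top f Fact.out (hA i))
      (integrableOn_Lp_of_measure_ne_top g Fact.out (hA i)), mul_add]
  map_smul' c f := by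
    ext i
    have h : ∫ ω in A i, (c • f : Lp 𝕜 p μ) ω ∂μ = ∫ ω in A i, c • f ω ∂μ :=
      integral_congr_ae (ae_restrict_of_ae (Lp.coeFn_smul c f))
    simp only [PiLp.smul_apply, RingHom.id_apply]
    rw [h, integral_smul]
    simp only [smul_eq_mul]
    ring

theorem averages_apply (A : ι → Set Ω) (hA : ∀ i, μ (A i) ≠ ∞) (f : Lp 𝕜 p μ) (i : ι) :
    averages A hA f i = ((μ.real (A i) ^ (1 / p.toReal - 1) : ℝ) : 𝕜) * ∫ ω in A i, f ω ∂μ := rfl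

/-- Hölder's inequality on `A i`. -/
theorem enorm_averages_apply_le (A : ι → Set Ω) (hA : ∀ i, μ (A i) ≠ ∞) (f : Lp 𝕜 p μ) (i : ι) :
    ‖averages A hA f i‖ₑ ≤ eLpNorm f p (μ.restrict (A i)) := by
  rw [averages_apply]
  rcases eq_or_ne (μ (A i)) 0 with h0 | h0
  · simp [Measure.restrict_eq_zero.2 h0]
  have hr : 0 < μ.real (A i) := ENNReal.toReal_pos h0 (hA i)
  have h1 : ‖∫ ω in A i, f ω ∂μ‖ₑ
      ≤ eLpNorm f p (μ.restrict (A i)) * μ (A i) ^ (1 - 1 / p.toReal) := by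
    refine (enorm_integral_le_lintegral_enorm _).trans ?_
    rw [← eLpNorm_one_eq_lintegral_enorm]
    refine (eLpNorm_le_eLpNorm_mul_rpow_measure_univ (q := p) Fact.out
      (Lp.aestronglyMeasurable f).restrict).trans ?_
    simp
  have h2 : ‖((μ.real (A i) ^ (1 / p.toReal - 1) : ℝ) : 𝕜)‖ₑ = μ (A i) ^ (1 / p.toReal - 1) := by
    rw [← ofReal_norm, RCLike.norm_ofReal, abs_of_nonneg (by positivity),
      ← ENNReal.ofReal_rpow_of_pos hr, ofReal_measureReal (hA i)]
  rw [enorm_mul, h2]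
  calc _ ≤ μ (A i) ^ (1 / p.toReal - 1) *
        (eLpNorm f p (μ.restrict (A i)) * μ (A i) ^ (1 - 1 / p.toReal)) := by gcongr
    _ = eLpNorm f p (μ.restrict (A i)) *
        (μ (A i) ^ (1 / p.toReal - 1) * μ (A i) ^ (1 - 1 / p.toReal)) := by ring
    _ = eLpNorm f p (μ.restrict (A i)) := by
      rw [← ENNReal.rpow_add _ _ h0 (hA i)]
      simp

theorem PiLp.enorm_rpow_eq_sum [Fintype ι] (hp : p ≠ ∞) (a : PiLp p (fun _ : ι => 𝕜)) :
    ‖a‖ₑ ^ p.toReal = ∑ i, ‖a i‖ₑ ^ p.toReal := by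
  have hp0 : 0 < p.toReal := ENNReal.toReal_pos (zero_lt_one.trans_le Fact.out).ne' hp
  have h : ‖a‖ ^ p.toReal = ∑ i, ‖a i‖ ^ p.toReal := by
    rw [PiLp.norm_eq_sum hp0, ← Real.rpow_mul (by positivity)]
    simp [hp0.ne']
  simp only [← ofReal_norm]
  rw [ENNReal.ofReal_rpow_of_nonneg (norm_nonneg _) hp0.le, h,
    ENNReal.ofReal_sum_of_nonneg fun _ _ => by positivity]
  simp only [ENNReal.ofReal_rpow_of_nonneg (norm_nonneg _) hp0.le]

theorem MeasureTheory.Lp.enorm_rpow_eq_lintegral (hp : p ≠ ∞) (f : Lp 𝕜 p μ) :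
    ‖f‖ₑ ^ p.toReal = ∫⁻ ω, ‖f ω‖ₑ ^ p.toReal ∂μ := by
  have hp1 : p ≠ 0 := (zero_lt_one.trans_le Fact.out).ne'
  have hp0 : 0 < p.toReal := ENNReal.toReal_pos hp1 hp
  rw [Lp.enorm_def, eLpNorm_eq_lintegral_rpow_enorm_toReal hp1 hp, ← ENNReal.rpow_mul]
  simp [hp0.ne']

/-- Averaging over disjoint sets is a contraction. -/
theorem norm_averages_le [Fintype ι] (hp : p ≠ ∞) (A : ι → Set Ω) (hA : ∀ i, μ (A i) ≠ ∞)
    (hm : ∀ i, MeasurableSet (A i)) (hd : Pairwise (Function.onFun Disjoint A)) (f : Lp 𝕜 p μ) :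
    ‖averages A hA f‖ ≤ ‖f‖ := by
  have hp1 : p ≠ 0 := (zero_lt_one.trans_le Fact.out).ne'
  have hp0 : 0 < p.toReal := ENNReal.toReal_pos hp1 hp
  rw [← enorm_le_iff_norm_le, ← ENNReal.rpow_le_rpow_iff hp0, PiLp.enorm_rpow_eq_sum hp,
    Lp.enorm_rpow_eq_lintegral hp]
  calc ∑ i, ‖averages A hA f i‖ₑ ^ p.toReal
      ≤ ∑ i, ∫⁻ ω in A i, ‖f ω‖ₑ ^ p.toReal ∂μ := by
        refine Finset.sum_le_sum fun i _ => ?_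
        refine (ENNReal.rpow_le_rpow (enorm_averages_apply_le A hA f i) hp0.le).trans_eq ?_
        rw [eLpNorm_eq_lintegral_rpow_enorm_toReal hp1 hp, ← ENNReal.rpow_mul]
        simp [hp0.ne']
    _ = ∫⁻ ω in ⋃ i ∈ (Finset.univ : Finset ι), A i, ‖f ω‖ₑ ^ p.toReal ∂μ :=
        (lintegral_biUnion_finset (fun i _ j _ hij => hd hij) (fun i _ => hm i) _).symm
    _ ≤ ∫⁻ ω, ‖f ω‖ₑ ^ p.toReal ∂μ := setLIntegral_le_lintegral _ _

/-- No norm is lost on a set on which `f` is constant. -/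
theorem enorm_averages_apply_of_eq (hp : p ≠ ∞) (A : ι → Set Ω) (hA : ∀ i, μ (A i) ≠ ∞)
    (hm : ∀ i, MeasurableSet (A i)) (f : Lp 𝕜 p μ) (i : ι) (c : 𝕜)
    (hf : ∀ᵐ ω ∂μ, ω ∈ A i → f ω = c) :
    ‖averages A hA f i‖ₑ ^ p.toReal = ‖c‖ₑ ^ p.toReal * μ (A i) := by
  have hp1 : p ≠ 0 := (zero_lt_one.trans_le Fact.out).ne'
  have hp0 : 0 < p.toReal := ENNReal.toReal_pos hp1 hp
  have h1 : ∫ ω in A i, f ω ∂μ = (μ.real (A i) : 𝕜) * c := by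
    rw [setIntegral_congr_ae (hm i) hf, setIntegral_const, RCLike.real_smul_eq_coe_mul]
  rw [averages_apply, h1]
  rcases eq_or_ne (μ (A i)) 0 with h0 | h0
  · simp [measureReal_def, h0, hp0]
  have hr : 0 < μ.real (A i) := ENNReal.toReal_pos h0 (hA i)
  have h2 : ((μ.real (A i) ^ (1 / p.toReal - 1) : ℝ) : 𝕜) * ((μ.real (A i) : 𝕜) * c)
      = ((μ.real (A i) ^ (1 / p.toReal) : ℝ) : 𝕜) * c := by
    rw [← mul_assoc, ← RCLike.ofReal_mul]
    congr 2
    nth_rw 2 [← Real.rpow_one (μ.real (A i))]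
    rw [← Real.rpow_add hr]
    simp
  rw [h2, enorm_mul, ENNReal.mul_rpow_of_nonneg _ _ hp0.le, mul_comm]
  congr 1
  rw [← ofReal_norm, RCLike.norm_ofReal, abs_of_nonneg (by positivity),
      ← ENNReal.ofReal_rpow_of_pos hr, ofReal_measureReal (hA i), ← ENNReal.rpow_mul]
  simp [hp0.ne']

/-- The map consists of the averages over the cells of a partition such that every `z i` is
`ε / 2`-close to a function which is constant on the cells. -/
theorem MeasureTheory.Lp.exists_linearMap_of_finite {𝕜 : Type u} [RCLike 𝕜] (hp : p ≠ ∞)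
    {m : ℕ} (z : Fin m → Lp 𝕜 p μ) {ε : ℝ} (hε : 0 < ε) :
    ∃ (ι : Type u) (_ : Fintype ι) (P : Lp 𝕜 p μ →ₗ[𝕜] PiLp p (fun _ : ι => 𝕜)),
        (∀ x, ‖P x‖ ≤ ‖x‖) ∧ ∀ i, ‖z i‖ - ε ≤ ‖P (z i)‖ := by
  classical
  have hp1 : p ≠ 0 := (zero_lt_one.trans_le Fact.out).ne'
  have hp0 : 0 < p.toReal := ENNReal.toReal_pos hp1 hp
  -- Approximating the vector `(z i)_i` by one vector-valued simple function `U` makes the fibres of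
  -- `U` a partition that serves all `i` at once. The fibre over `0` may have infinite measure.
  have hZ : MemLp (fun ω i => z i ω) p μ := MemLp.of_eval fun i => Lp.memLp (z i)
  obtain ⟨U, hU, hUm⟩ := hZ.exists_simpleFunc_eLpNorm_sub_lt hp
    (ε := ENNReal.ofReal (ε / 2)) (by simpa using hε)
  let ι := {v : Fin m → 𝕜 // v ∈ U.range.erase 0}
  let A : ι → Set Ω := fun v => U ⁻¹' {v.1}
  have hA : ∀ v, μ (A v) ≠ ∞ := fun v =>
    (U.measure_preimage_lt_top_of_memLp hp1 hp hUm v.1 (Finset.ne_of_mem_erase v.2)).ne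
  have hm : ∀ v, MeasurableSet (A v) := fun v => U.measurableSet_fiber _
  have hd : Pairwise (Function.onFun Disjoint A) := fun v w hvw =>
    (Set.disjoint_singleton.2 fun h => hvw (Subtype.ext h)).preimage _
  refine ⟨ι, inferInstance, averages A hA, norm_averages_le hp A hA hm hd, fun i => ?_⟩
  have hui : MemLp (fun ω => U ω i) p μ := hUm.eval i
  let u : Lp 𝕜 p μ := hui.toLp
  have hu : u =ᵐ[μ] fun ω => U ω i := hui.coeFn_toLp
  have h1 : ‖averages A hA u‖ = ‖u‖ := by
    have : ‖averages A hA u‖ₑ ^ p.toReal = ‖u‖ₑ ^ p.toReal := by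
      rw [PiLp.enorm_rpow_eq_sum hp, Lp.enorm_rpow_eq_lintegral hp]
      have h2 : ∫⁻ ω, ‖u ω‖ₑ ^ p.toReal ∂μ
          = ∫⁻ ω, U.map (fun v => ‖v i‖ₑ ^ p.toReal) ω ∂μ :=
        lintegral_congr_ae (hu.mono fun ω hω => by simp [hω])
      rw [h2, SimpleFunc.lintegral_eq_lintegral, SimpleFunc.map_lintegral]
      let g : (Fin m → 𝕜) → ℝ≥0∞ := fun v => ‖v i‖ₑ ^ p.toReal * μ (U ⁻¹' {v})
      change _ = ∑ v ∈ U.range, g v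
      rw [← Finset.sum_erase U.range (a := 0) (f := g) (by simp [g, hp0]),
        ← Finset.sum_coe_sort (U.range.erase 0) g]
      refine Finset.sum_congr rfl fun v _ => ?_
      refine enorm_averages_apply_of_eq hp A hA hm u v (v.1 i) (hu.mono fun ω hω hωv => ?_)
      have : U ω = v.1 := hωv
      exact hω.trans (congrFun this i)
    have h3 := (ENNReal.rpow_left_injective hp0.ne') this
    rw [← toReal_enorm, ← toReal_enorm, h3]
  have h2 : ‖z i - u‖ ≤ ε / 2 := by
    have h3 : ‖z i - u‖ₑ ≤ ENNReal.ofReal (ε / 2) := by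
      rw [Lp.enorm_def]
      refine le_trans ?_ hU.le
      refine eLpNorm_mono_ae ?_
      filter_upwards [Lp.coeFn_sub (z i) u, hu] with ω h h'
      rw [h, Pi.sub_apply, h']
      exact norm_le_pi_norm ((fun i => z i ω) - U ω) i
    rw [← ofReal_norm] at h3
    exact (ENNReal.ofReal_le_ofReal_iff (by positivity)).1 h3
  have h3 : ‖z i‖ - ‖z i - u‖ ≤ ‖u‖ := by simpa using norm_sub_norm_le (z i) (z i - u)
  have h4 : ‖averages A hA u‖ - ‖averages A hA (z i - u)‖ ≤ ‖averages A hA (z i)‖ := by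
    have := norm_sub_le_norm_add (averages A hA u) (averages A hA (z i - u))
    rwa [← map_add, add_sub_cancel] at this
  have h5 := norm_averages_le hp A hA hm hd (z i - u)
  linarith
end

/-! ### A partition of unity along dyadic shells -/

/-- The piecewise linear function that is `0` up to `2 ^ k` and `1` from `2 ^ (k + 1)` on. -/
noncomputable def ramp (k : ℕ) (t : ℝ) : ℝ := max 0 (min 1 (t / 2 ^ k - 1))

theorem ramp_nonneg (k : ℕ) (t : ℝ) : 0 ≤ ramp k t := le_max_left _ _

theorem ramp_le_one (k : ℕ) (t : ℝ) : ramp k t ≤ 1 := max_le zero_le_one (min_le_left _ _)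

theorem ramp_mono (k : ℕ) : Monotone (ramp k) := fun s t h => by
  unfold ramp; gcongr

theorem ramp_eq_zero {k : ℕ} {t : ℝ} (h : t ≤ 2 ^ k) : ramp k t = 0 := by
  have : t / 2 ^ k ≤ 1 := by rw [div_le_one (by positivity)]; exact h
  exact max_eq_left ((min_le_right _ _).trans (by linarith))

theorem ramp_eq_one {k : ℕ} {t : ℝ} (h : 2 ^ (k + 1) ≤ t) : ramp k t = 1 := by
  have : 2 ≤ t / 2 ^ k := by rw [le_div_iff₀ (by positivity)]; rw [pow_succ] at h; linarith
  unfold ramp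
  rw [min_eq_left (by linarith), max_eq_right zero_le_one]

theorem ramp_sub_le {k : ℕ} {s t : ℝ} (h : s ≤ t) : ramp k t - ramp k s ≤ (t - s) / 2 ^ k := by
  have h1 : (0 : ℝ) ≤ (t - s) / 2 ^ k := div_nonneg (by linarith) (by positivity)
  have h2 : t / 2 ^ k = s / 2 ^ k + (t - s) / 2 ^ k := by ring
  have h3 : ramp k t ≤ ramp k s + (t - s) / 2 ^ k := by
    unfold ramp
    rw [h2]
    refine max_le (add_nonneg (le_max_left _ _) h1) ?_
    rcases le_total 1 (s / 2 ^ k - 1) with h | h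
    · rw [min_eq_left h, max_eq_right zero_le_one]
      exact (min_le_left _ _).trans (by linarith)
    · rw [min_eq_right h]
      exact (min_le_right _ _).trans (by linarith [le_max_right 0 (s / 2 ^ k - 1)])
  linarith

/-- The ramp has slope `2 ^ (-k)`, and it is constant beyond `2 ^ (k + 1)`. -/
theorem ramp_sub_mul_le {k : ℕ} {s t : ℝ} (hs : 0 ≤ s) (h : s ≤ t) :
    (ramp k t - ramp k s) * s ≤ 2 * (t - s) := by
  rcases le_total (2 ^ (k + 1)) s with h1 | h1
  · rw [ramp_eq_one h1, ramp_eq_one (h1.trans h)]; linarith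
  · calc _ ≤ (t - s) / 2 ^ k * 2 ^ (k + 1) := by
          exact mul_le_mul (ramp_sub_le h) h1 hs (div_nonneg (by linarith) (by positivity))
      _ = 2 * (t - s) := by rw [pow_succ]; field_simp

/-- A partition of unity on `[0, ∞)`: for `k ≥ 1`, `tent k` is supported on `[2 ^ (k - 1), 2 ^ (k + 1)]`,
and `tent 0` on `[0, 2]`. -/
noncomputable def tent : ℕ → ℝ → ℝ
  | 0, t => 1 - ramp 0 t
  | k + 1, t => ramp k t - ramp (k + 1) t

theorem sum_range_tent (n : ℕ) (t : ℝ) :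
    ∑ k ∈ Finset.range (n + 1), tent k t = 1 - ramp n t := by
  induction n with
  | zero => simp [tent]
  | succ n ih => rw [Finset.sum_range_succ, ih]; simp [tent]

theorem sum_tent_eq_one {n : ℕ} {t : ℝ} (h : t ≤ 2 ^ n) :
    ∑ k ∈ Finset.range (n + 1), tent k t = 1 := by
  rw [sum_range_tent, ramp_eq_zero h, sub_zero]

theorem tent_eq_zero_of_le {k : ℕ} {t : ℝ} (h : 2 ^ (k + 1) ≤ t) : tent k t = 0 := by
  cases k with
  | zero => simp [tent, ramp_eq_one h]
  | succ k =>
    have h' : (2 : ℝ) ^ (k + 1) ≤ t :=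
      (pow_le_pow_right₀ one_le_two (Nat.le_succ _)).trans h
    simp [tent, ramp_eq_one h, ramp_eq_one h']

theorem tent_eq_zero_of_ge {k : ℕ} {t : ℝ} (h : t ≤ 2 ^ k) : tent (k + 1) t = 0 := by
  have h' : t ≤ (2 : ℝ) ^ (k + 1) := h.trans (pow_le_pow_right₀ one_le_two (Nat.le_succ _))
  simp [tent, ramp_eq_zero h, ramp_eq_zero h']

theorem exists_forall_tent_eq_zero (t : ℝ) : ∃ m : ℕ, ∀ k, k ≠ m → k ≠ m + 1 → tent k t = 0 := by
  -- The least `n` with `t ≤ 2 ^ n`; only `tent (n - 1)` and `tent n` can be nonzero at `t`.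
  classical
  have hex : ∃ n : ℕ, t ≤ 2 ^ n := (pow_unbounded_of_one_lt t one_lt_two).imp fun _ h => h.le
  rcases Nat.eq_zero_or_pos (Nat.find hex) with h0 | h0
  · refine ⟨0, fun k hk _ => ?_⟩
    obtain ⟨l, rfl⟩ := Nat.exists_eq_succ_of_ne_zero hk
    refine tent_eq_zero_of_ge ((Nat.find_spec hex).trans ?_)
    exact pow_le_pow_right₀ one_le_two (by omega)
  · refine ⟨Nat.find hex - 1, fun k hk hk' => ?_⟩
    have h1 : (2 : ℝ) ^ (Nat.find hex - 1) < t := not_le.1 (Nat.find_min hex (by omega))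
    rcases lt_or_ge k (Nat.find hex) with h | h
    · exact tent_eq_zero_of_le ((pow_le_pow_right₀ one_le_two (by omega)).trans h1.le)
    · obtain ⟨l, rfl⟩ := Nat.exists_eq_succ_of_ne_zero (n := k) (by omega)
      refine tent_eq_zero_of_ge ((Nat.find_spec hex).trans ?_)
      exact pow_le_pow_right₀ one_le_two (by omega)

section
variable (𝕜 : Type*) [RCLike 𝕜] {X : Type*} [NormedAddCommGroup X] [NormedSpace 𝕜 X]

theorem norm_ramp_smul_sub_le (k : ℕ) (x y : X) :
    ‖((ramp k ‖x‖ : ℝ) : 𝕜) • x - ((ramp k ‖y‖ : ℝ) : 𝕜) • y‖ ≤ 3 * ‖x - y‖ := by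
  wlog h : ‖y‖ ≤ ‖x‖ generalizing x y
  · rw [norm_sub_rev, norm_sub_rev x y]
    exact this y x (le_of_not_ge h)
  have h1 : ((ramp k ‖x‖ : ℝ) : 𝕜) • x - ((ramp k ‖y‖ : ℝ) : 𝕜) • y
      = ((ramp k ‖x‖ : ℝ) : 𝕜) • (x - y) + ((ramp k ‖x‖ - ramp k ‖y‖ : ℝ) : 𝕜) • y := by
    push_cast
    module
  rw [h1]
  refine (norm_add_le _ _).trans ?_
  rw [norm_smul, norm_smul, RCLike.norm_ofReal, RCLike.norm_ofReal, abs_of_nonneg (ramp_nonneg _ _),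
    abs_of_nonneg (sub_nonneg.2 (ramp_mono k h))]
  have h2 := ramp_sub_mul_le (k := k) (norm_nonneg y) h
  have h3 := norm_sub_norm_le x y
  have h4 : ramp k ‖x‖ * ‖x - y‖ ≤ 1 * ‖x - y‖ := by gcongr; exact ramp_le_one _ _
  linarith

/-- The part `tent k ‖x‖ • x` of `x` that belongs to the `k`-th shell. -/
noncomputable def tentSMul (k : ℕ) (x : X) : X := ((tent k ‖x‖ : ℝ) : 𝕜) • x

theorem norm_tentSMul_sub_le (k : ℕ) (x y : X) :
    ‖tentSMul 𝕜 k x - tentSMul 𝕜 k y‖ ≤ 6 * ‖x - y‖ := by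
  cases k with
  | zero =>
    have h : tentSMul 𝕜 0 x - tentSMul 𝕜 0 y
        = (x - y) - (((ramp 0 ‖x‖ : ℝ) : 𝕜) • x - ((ramp 0 ‖y‖ : ℝ) : 𝕜) • y) := by
      simp only [tentSMul, tent]; push_cast; module
    rw [h]
    have := norm_ramp_smul_sub_le 𝕜 0 x y
    have h0 := norm_nonneg (x - y)
    exact (norm_sub_le _ _).trans (by linarith)
  | succ k =>
    have h : tentSMul 𝕜 (k + 1) x - tentSMul 𝕜 (k + 1) y
        = (((ramp k ‖x‖ : ℝ) : 𝕜) • x - ((ramp k ‖y‖ : ℝ) : 𝕜) • y) -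
          (((ramp (k + 1) ‖x‖ : ℝ) : 𝕜) • x - ((ramp (k + 1) ‖y‖ : ℝ) : 𝕜) • y) := by
      simp only [tentSMul, tent]; push_cast; module
    rw [h]
    have h1 := norm_ramp_smul_sub_le 𝕜 k x y
    have h2 := norm_ramp_smul_sub_le 𝕜 (k + 1) x y
    exact (norm_sub_le _ _).trans (by linarith)

theorem continuous_tentSMul (k : ℕ) : Continuous (tentSMul 𝕜 k : X → X) :=
  (LipschitzWith.of_dist_le_mul (K := 6) fun x y => by
    simpa [dist_eq_norm] using norm_tentSMul_sub_le 𝕜 k x y).continuous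

theorem tentSMul_eq_zero {k : ℕ} {x : X} (h : tent k ‖x‖ = 0) : tentSMul 𝕜 k x = 0 := by
  simp [tentSMul, h]

theorem exists_sum_tentSMul_eq (x : X) :
    ∃ N : ℕ, ∀ n, N ≤ n → ∑ k ∈ Finset.range n, tentSMul 𝕜 k x = x := by
  obtain ⟨N, hN⟩ := pow_unbounded_of_one_lt ‖x‖ (one_lt_two (α := ℝ))
  refine ⟨N + 1, fun n hn => ?_⟩
  obtain ⟨n, rfl⟩ := Nat.exists_eq_succ_of_ne_zero (n := n) (by omega)
  have h := sum_tent_eq_one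
    (hN.le.trans (pow_le_pow_right₀ one_le_two (show N ≤ n by omega)))
  simp only [tentSMul]
  rw [← Finset.sum_smul, ← map_sum (algebraMap ℝ 𝕜)]
  simp [h]

/-- At most four shells see a given pair of points. -/
theorem exists_finset_tentSMul_eq_zero (x y : X) : ∃ S : Finset ℕ, S.card ≤ 4 ∧
    ∀ k, k ∉ S → tentSMul 𝕜 k x = 0 ∧ tentSMul 𝕜 k y = 0 := by
  obtain ⟨m, hm⟩ := exists_forall_tent_eq_zero ‖x‖
  obtain ⟨n, hn⟩ := exists_forall_tent_eq_zero ‖y‖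
  refine ⟨{m, m + 1, n, n + 1}, Finset.card_le_four, fun k hk => ?_⟩
  simp only [Finset.mem_insert, Finset.mem_singleton, not_or] at hk
  exact ⟨tentSMul_eq_zero 𝕜 (hm k hk.1 hk.2.1), tentSMul_eq_zero 𝕜 (hn k hk.2.2.1 hk.2.2.2)⟩

/-- `x - y` is the sum of at most four nonzero differences, one of which has at least the average norm. -/
theorem exists_le_norm_tentSMul_sub (x y : X) :
    ∃ k, ‖x - y‖ ≤ 4 * ‖tentSMul 𝕜 k x - tentSMul 𝕜 k y‖ := by
  obtain ⟨S, hS4, hS⟩ := exists_finset_tentSMul_eq_zero 𝕜 x y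
  obtain ⟨N, hN⟩ := exists_sum_tentSMul_eq 𝕜 x
  obtain ⟨N', hN'⟩ := exists_sum_tentSMul_eq 𝕜 y
  by_contra! hcon
  obtain ⟨n, hnS⟩ := S.exists_nat_subset_range
  have hxy : 0 < ‖x - y‖ := (by positivity : (0 : ℝ) ≤ _).trans_lt (hcon 0)
  set m := max n (max N N')
  have h1 : x - y = ∑ k ∈ S, (tentSMul 𝕜 k x - tentSMul 𝕜 k y) := by
    have h2 : ∑ k ∈ S, (tentSMul 𝕜 k x - tentSMul 𝕜 k y)
        = ∑ k ∈ Finset.range m, (tentSMul 𝕜 k x - tentSMul 𝕜 k y) := by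
      apply Finset.sum_subset
      · exact hnS.trans (Finset.range_mono (le_max_left _ _))
      · intro k _ hk
        rw [(hS k hk).1, (hS k hk).2, sub_zero]
    rw [h2, Finset.sum_sub_distrib, hN m (by omega), hN' m (by omega)]
  have hSne : S.Nonempty := by
    rw [Finset.nonempty_iff_ne_empty]
    rintro rfl
    simp [h1] at hxy
  have h3 : ‖x - y‖ < ∑ _k ∈ S, ‖x - y‖ / 4 := by
    conv_lhs => rw [h1]
    exact (norm_sum_le _ _).trans_lt
      (Finset.sum_lt_sum_of_nonempty hSne fun k _ => by linarith [hcon k])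
  rw [Finset.sum_const, nsmul_eq_mul] at h3
  have h4 : (S.card : ℝ) ≤ 4 := by exact_mod_cast hS4
  nlinarith

theorem isCompact_image_tentSMul {A : Set X} (hA : ∀ R, IsCompact (A ∩ Metric.closedBall 0 R))
    (k : ℕ) : IsCompact (insert 0 (tentSMul 𝕜 k '' A)) := by
  have h : insert 0 (tentSMul 𝕜 k '' A)
      = insert 0 (tentSMul 𝕜 k '' (A ∩ Metric.closedBall 0 (2 ^ (k + 1)))) := by
    refine Set.Subset.antisymm (Set.insert_subset (Set.mem_insert _ _) ?_)
      (Set.insert_subset_insert (Set.image_mono Set.inter_subset_left))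
    rintro _ ⟨x, hx, rfl⟩
    rcases le_total ‖x‖ (2 ^ (k + 1)) with hn | hn
    · exact Set.mem_insert_of_mem _ ⟨x, ⟨hx, by simpa using hn⟩, rfl⟩
    · rw [tentSMul_eq_zero 𝕜 (tent_eq_zero_of_le hn)]
      exact Set.mem_insert _ _
  rw [h]
  exact ((hA _).image (continuous_tentSMul 𝕜 k)).insert 0
end

/-! ### The glued map -/

/-- A gauge is dominated by `2 ^ (-j)` above a suitable scale: `s j` is chosen with `φ ≤ 2 ^ (-(j + 1))`
below `s j`, and `j` is the least index with `s j ≤ t`. For `j = 0` the bound is `φ ≤ 1`. -/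
theorem exists_scales {φ : ℝ≥0 → ℝ} (hφ : φ ∈ almostLipschitzGauges) :
    ∃ s : ℕ → ℝ, (∀ j, 0 < s j) ∧ ∀ t : ℝ≥0, 0 < t → ∃ j, s j ≤ t ∧ φ t ≤ (1 / 2) ^ j := by
  obtain ⟨hc, hI, h0, -⟩ := hφ
  have h1 : ∀ j : ℕ, ∃ s : ℝ, 0 < s ∧ s ≤ 1 / (j + 1) ∧
      ∀ t : ℝ≥0, (t : ℝ) < s → φ t ≤ (1 / 2) ^ (j + 1) := fun j => by
    have hpos : (0 : ℝ) < (1 / 2) ^ (j + 1) := by positivity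
    obtain ⟨δ, hδ, h⟩ := Metric.continuousAt_iff.1 (hc.continuousAt (x := 0)) _ hpos
    refine ⟨min δ (1 / (j + 1)), lt_min hδ (by positivity), min_le_right _ _, fun t ht => ?_⟩
    have h2 : dist t 0 < δ := by
      rw [NNReal.dist_eq]
      simpa using ht.trans_le (min_le_left _ _)
    have h3 := h h2
    rw [h0, Real.dist_eq, sub_zero] at h3
    exact (le_abs_self _).trans h3.le
  choose s hs0 hs1 hs using h1
  refine ⟨s, hs0, fun t ht => ?_⟩
  classical
  have hex : ∃ j, s j ≤ t := by
    obtain ⟨j, hj⟩ := exists_nat_one_div_lt (show (0 : ℝ) < t from ht)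
    exact ⟨j, (hs1 j).trans hj.le⟩
  refine ⟨Nat.find hex, Nat.find_spec hex, ?_⟩
  rcases Nat.eq_zero_or_pos (Nat.find hex) with h | h
  · rw [h, pow_zero]
    exact (hI t).2.le
  · obtain ⟨j, hj⟩ := Nat.exists_eq_succ_of_ne_zero h.ne'
    rw [hj]
    exact hs j t (not_le.1 (Nat.find_min hex (by omega)))

/-- The glued map. Pairs of a shell `k` and a scale `j` are enumerated by `Nat.unpair`. -/
theorem exists_sum_of_scales {𝕜 : Type*} [RCLike 𝕜] {p : ℝ≥0∞} [Fact (1 ≤ p)]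
    {X : Type*} [NormedAddCommGroup X] [NormedSpace 𝕜 X]
    (hX : ∀ (K : Set X) (ε : ℝ), IsCompact K → 0 < ε →
      ∃ (n : ℕ) (P : X →ₗ[𝕜] PiLp p (fun _ : Fin n => 𝕜)),
        (∀ x, ‖P x‖ ≤ ‖x‖) ∧ ∀ x ∈ K, ‖x‖ - ε ≤ ‖P x‖)
    {Y : Type*} [NormedAddCommGroup Y] [NormedSpace 𝕜 Y] [CompleteSpace Y] {C C' : ℝ}
    (hY : ContainsEllpnWithConst 𝕜 p C Y) (hC : C < C') (hC0 : 0 < C')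
    {A : Set X} (hA : ∀ R, IsCompact (A ∩ Metric.closedBall 0 R))
    {s : ℕ → ℝ} (hs : ∀ j, 0 < s j) :
    ∃ f : X → Y, (∀ x y, ‖f x - f y‖ ≤ 48 * C' * ‖x - y‖) ∧
      ∀ x ∈ A, ∀ y ∈ A, ∀ j, s j ≤ ‖x - y‖ → (1 / 2) ^ j * ‖x - y‖ ≤ 32 * ‖f x - f y‖ := by
  -- `B k` contains the `k`-th parts of the points of `A`, and `K k` the differences of such parts.
  let B : ℕ → Set X := fun k => insert 0 (tentSMul 𝕜 k '' A)
  let K : ℕ → Set X := fun k => (fun q : X × X => q.1 - q.2) '' (B k ×ˢ B k)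
  have hB : ∀ k, IsCompact (B k) := fun k => isCompact_image_tentSMul 𝕜 hA k
  have hK : ∀ k, IsCompact (K k) := fun k => ((hB k).prod (hB k)).image continuous_sub
  choose n P hP hPK using fun i : ℕ =>
    hX (K i.unpair.1) (s i.unpair.2 / 8) (hK _) (by have := hs i.unpair.2; positivity)
  obtain ⟨T, hT, hTsum⟩ := hY.exists_sequence hC hC0 n
  -- The coordinates of the map, as functions of the sequence `z` of the parts of a vector in the
  -- shells.
  let H : (ℕ → X) → ∀ i, PiLp p (fun _ : Fin (n i) => 𝕜) := fun z i =>
    (((1 / 2) ^ i.unpair.2 : ℝ) : 𝕜) • P i (z i.unpair.1)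
  have hHn : ∀ z i, ‖H z i‖ = (1 / 2) ^ i.unpair.2 * ‖P i (z i.unpair.1)‖ := fun z i => by
    rw [norm_smul, RCLike.norm_ofReal, abs_of_nonneg (by positivity)]
  have hgeo : HasSum (fun j : ℕ => (1 / 2 : ℝ) ^ j) 2 := hasSum_geometric_two
  have hbound : ∀ (z : ℕ → X) (S : Finset ℕ), (∀ k ∉ S, z k = 0) →
      HasSum (fun i : ℕ => ‖z i.unpair.1‖ * (1 / 2 : ℝ) ^ i.unpair.2)
        ((∑ k ∈ S, ‖z k‖) * 2) := fun z S hS => by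
    have h1 : HasSum (fun k => ‖z k‖) (∑ k ∈ S, ‖z k‖) :=
      hasSum_sum_of_ne_finset_zero fun k hk => by simp [hS k hk]
    have h2 : HasSum (fun q : ℕ × ℕ => ‖z q.1‖ * (1 / 2 : ℝ) ^ q.2) ((∑ k ∈ S, ‖z k‖) * 2) :=
      h1.mul hgeo (h1.summable.mul_of_nonneg hgeo.summable (fun _ => norm_nonneg _)
        fun _ => by positivity)
    exact (Nat.pairEquiv.symm.hasSum_iff (f := fun q : ℕ × ℕ => ‖z q.1‖ * (1 / 2 : ℝ) ^ q.2)).2 h2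
  have hle : ∀ z i, ‖T i (H z i)‖ ≤ C' * (‖z i.unpair.1‖ * (1 / 2 : ℝ) ^ i.unpair.2) :=
      fun z i => by
    refine (hT i _).trans ?_
    rw [hHn, mul_comm ((1 / 2 : ℝ) ^ _)]
    gcongr
    exact hP i _
  have hsummable : ∀ (z : ℕ → X) (S : Finset ℕ), (∀ k ∉ S, z k = 0) →
      Summable fun i => T i (H z i) := fun z S hS =>
    .of_norm_bounded ((hbound z S hS).summable.mul_left C') (hle z)
  have hnorm : ∀ (z : ℕ → X) (S : Finset ℕ), (∀ k ∉ S, z k = 0) →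
      ‖∑' i, T i (H z i)‖ ≤ C' * ((∑ k ∈ S, ‖z k‖) * 2) := fun z S hS =>
    tsum_of_norm_bounded ((hbound z S hS).mul_left C') (hle z)
  have hlow : ∀ (z : ℕ → X) (S : Finset ℕ), (∀ k ∉ S, z k = 0) →
      ∀ i, (1 / 2) ^ i.unpair.2 * ‖P i (z i.unpair.1)‖ ≤ 4 * ‖∑' l, T l (H z l)‖ :=
    fun z S hS i => (hHn z i).symm.trans_le (hTsum (H z) (hsummable z S hS) i)
  let Λ : X → ℕ → X := fun x k => tentSMul 𝕜 k x
  have hsub : ∀ x y, ∑' i, T i (H (Λ x) i) - ∑' i, T i (H (Λ y) i)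
      = ∑' i, T i (H (fun k => Λ x k - Λ y k) i) := fun x y => by
    obtain ⟨S, -, hS⟩ := exists_finset_tentSMul_eq_zero 𝕜 x y
    rw [← (hsummable _ S fun k hk => (hS k hk).1).tsum_sub
      (hsummable _ S fun k hk => (hS k hk).2)]
    refine tsum_congr fun i => ?_
    rw [← map_sub]
    simp only [H, Λ, map_sub, smul_sub]
  refine ⟨fun x => ∑' i, T i (H (Λ x) i), fun x y => ?_, fun x hx y hy j hj => ?_⟩
  · obtain ⟨S, hS4, hS⟩ := exists_finset_tentSMul_eq_zero 𝕜 x y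
    have hz : ∀ k ∉ S, Λ x k - Λ y k = 0 := fun k hk => by
      simp only [Λ, (hS k hk).1, (hS k hk).2, sub_zero]
    rw [hsub]
    refine (hnorm _ S hz).trans ?_
    have h1 : ∑ k ∈ S, ‖Λ x k - Λ y k‖ ≤ 24 * ‖x - y‖ :=
      calc _ ≤ ∑ _k ∈ S, 6 * ‖x - y‖ :=
            Finset.sum_le_sum fun k _ => norm_tentSMul_sub_le 𝕜 k x y
        _ = S.card * (6 * ‖x - y‖) := by rw [Finset.sum_const, nsmul_eq_mul]
        _ ≤ 4 * (6 * ‖x - y‖) := by gcongr; exact_mod_cast hS4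
        _ = 24 * ‖x - y‖ := by ring
    calc _ ≤ C' * (24 * ‖x - y‖ * 2) := by gcongr
      _ = 48 * C' * ‖x - y‖ := by ring
  · obtain ⟨S, -, hS⟩ := exists_finset_tentSMul_eq_zero 𝕜 x y
    have hz : ∀ k ∉ S, Λ x k - Λ y k = 0 := fun k hk => by
      simp only [Λ, (hS k hk).1, (hS k hk).2, sub_zero]
    obtain ⟨k, hk⟩ := exists_le_norm_tentSMul_sub 𝕜 x y
    set w : X := tentSMul 𝕜 k x - tentSMul 𝕜 k y with hw
    have hwK : w ∈ K k := ⟨(tentSMul 𝕜 k x, tentSMul 𝕜 k y),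
      ⟨Set.mem_insert_of_mem _ ⟨x, hx, rfl⟩, Set.mem_insert_of_mem _ ⟨y, hy, rfl⟩⟩, rfl⟩
    have h1 := hlow (fun k => Λ x k - Λ y k) S hz (Nat.pair k j)
    rw [← hsub] at h1
    have h2 := hPK (Nat.pair k j) w
    simp only [Nat.unpair_pair, Λ, ← hw] at h1 h2
    have h3 := h2 hwK
    -- `‖P w‖ ≥ ‖w‖ - s j / 8 ≥ ‖x - y‖ / 4 - ‖x - y‖ / 8`.
    have h4 : ‖x - y‖ ≤ 8 * ‖P (Nat.pair k j) w‖ := by linarith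
    calc (1 / 2 : ℝ) ^ j * ‖x - y‖ ≤ (1 / 2) ^ j * (8 * ‖P (Nat.pair k j) w‖) := by gcongr
      _ = 8 * ((1 / 2) ^ j * ‖P (Nat.pair k j) w‖) := by ring
      _ ≤ 8 * (4 * _) := mul_le_mul_of_nonneg_left h1 (by norm_num)
      _ = 32 * _ := by ring

theorem MeasureTheory.Lp.exists_linearMap_of_isCompact {𝕜 : Type*} [RCLike 𝕜] {p : ℝ≥0∞} [Fact (1 ≤ p)]
    {Ω : Type*} [MeasurableSpace Ω] {μ : Measure Ω} (K : Set (Lp 𝕜 p μ)) (ε : ℝ)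
    (hK : IsCompact K) (hε : 0 < ε) :
    ∃ (n : ℕ) (P : Lp 𝕜 p μ →ₗ[𝕜] PiLp p (fun _ : Fin n => 𝕜)),
      (∀ x, ‖P x‖ ≤ ‖x‖) ∧ ∀ x ∈ K, ‖x‖ - ε ≤ ‖P x‖ := by
  rcases eq_or_ne p ∞ with rfl | hp
  · refine exists_linearMap_of_finite_of_isCompact (fun m z ε hε => ?_) hK hε
    obtain ⟨P, hP, hPz⟩ := exists_linearMap_of_finite_top 𝕜 z
    exact ⟨Fin m, inferInstance, P, hP, fun i => (sub_le_self _ hε.le).trans (hPz i)⟩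
  · exact exists_linearMap_of_finite_of_isCompact
      (fun m z ε hε => Lp.exists_linearMap_of_finite hp z hε) hK hε

theorem mainTheorem2 {𝕜 : Type*} [RCLike 𝕜] (p : ℝ≥0∞) [Fact (1 ≤ p)]
    {Ω : Type*} [MeasurableSpace Ω] (μ : Measure Ω)
    (M : Set (Lp 𝕜 p μ)) (hM : ProperSpace M)
    {Y : Type*} [NormedAddCommGroup Y] [NormedSpace 𝕜 Y] [CompleteSpace Y]
    (hY : ContainsEllpnUniformly 𝕜 p Y) :
    AlmostLipschitzEmbeds M Y := by
  obtain ⟨C, hC1, hC⟩ := hY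
  refine ⟨1 / 32, 32 * (48 * (C + 1)), by norm_num, by linarith, fun φ hφ => ?_⟩
  rcases isEmpty_or_nonempty M with hE | ⟨⟨x₀, hx₀⟩⟩
  · exact ⟨fun _ => 0, fun x => hE.elim x⟩
  obtain ⟨s, hs, hφs⟩ := exists_scales hφ
  have hA : ∀ R, IsCompact ((fun x => x - x₀) '' M ∩ Metric.closedBall 0 R) := fun R => by
    have h1 : (fun x => x - x₀) '' M ∩ Metric.closedBall 0 R
        = (fun x : M => (x : Lp 𝕜 p μ) - x₀) '' Metric.closedBall ⟨x₀, hx₀⟩ R := by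
      ext z
      constructor
      · rintro ⟨⟨x, hx, rfl⟩, hz⟩
        refine ⟨⟨x, hx⟩, ?_, rfl⟩
        simpa [dist_eq_norm, Subtype.dist_eq] using hz
      · rintro ⟨x, hx, rfl⟩
        refine ⟨⟨x, x.2, rfl⟩, ?_⟩
        simpa [dist_eq_norm, Subtype.dist_eq] using hx
    rw [h1]
    exact (isCompact_closedBall _ _).image (by fun_prop)
  -- The infimum in the Banach-Mazur distance need not be attained, so `C` is replaced by `C + 1`.
  obtain ⟨f, hf1, hf2⟩ := exists_sum_of_scales Lp.exists_linearMap_of_isCompact hC (lt_add_one C)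
    (by linarith) hA hs
  refine ⟨fun x => f (x - x₀), fun x y => ?_⟩
  have hd : ‖((x : Lp 𝕜 p μ) - x₀) - (y - x₀)‖ = dist x y := by
    rw [sub_sub_sub_cancel_right, Subtype.dist_eq, dist_eq_norm]
  rw [dist_eq_norm (f _)]
  constructor
  · rcases eq_or_ne x y with rfl | hxy
    · simp
    obtain ⟨j, hj, hφj⟩ := hφs (nndist x y)
      (by rw [← NNReal.coe_pos, coe_nndist]; exact dist_pos.2 hxy)
    have h1 := hf2 (x - x₀) ⟨x, x.2, rfl⟩ (y - x₀) ⟨y, y.2, rfl⟩ j (by rw [hd]; exact hj)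
    rw [hd] at h1
    have h2 : φ (nndist x y) * dist x y ≤ (1 / 2) ^ j * dist x y := by gcongr
    linarith
  · have h1 := hf1 (x - x₀) (y - x₀)
    rw [hd] at h1
    linarith
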